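/- Let $d\ge 1$, let $D\subset\mathbb{R}^d$ be a bounded open set, and let $\{D_\ell\}_{\ell}$ be a finite family of pairwise disjoint open subsets of $D$ with $D\subseteq\bigcup_\ell\overline{D_\ell}$ (a non-overlapping partition of $D$). Let $\{\mathcal{O}_\ell\}_\ell$ be open sets with $D_\ell\subseteq\mathcal{O}_\ell\subseteq D$ (an overlapping decomposition of $D$). Put $H=H^1_0(D)$, $\widehat{G}=\prod_\ell H^1(\mathcal{O}_\ell)$ and $G=\prod_\ell H^1_0(\mathcal{O}_\ell)\subset\widehat{G}$, and let $$a(u,v)=\int_D\nabla u\cdot\nabla v,\qquad b(\{v_\ell\},\{w_\ell\})=\sum_\ell\Big(\int_{\mathcal{O}_\ell}\nabla v_\ell\cdot\nabla w_\ell+\int_{\partial\mathcal{O}_\ell}v_\ell w_\ell\Big),$$ and, for $\epsilon>0$, $$c_\epsilon(\{v_\ell\},\{w_\ell\})=\sum_\ell\int_{D_\ell}\nabla v_\ell\cdot\nabla w_\ell+\epsilon\sum_\ell\int_{\mathcal{O}_\ell\setminus D_\ell}\nabla v_\ell\cdot\nabla w_\ell+\sum_\ell\int_{\partial\mathcal{O}_\ell}v_\ell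 w_\ell .$$ The boundary integrals are taken of traces. If $\mathcal{O}_\ell$ is not Lipschitz, the trace of $v\in H^1(\mathcal{O}_\ell)$ is understood as the element of least $L^2(\partial\mathcal{O}_\ell)$-norm among the limits in $L^2(\partial\mathcal{O}_\ell)$ of sequences in $C_c^\infty(\mathbb{R}^d)$ that converge to $v$ in $H^1(\mathcal{O}_\ell)$, and as $0$ if there is no such limit; in every case the boundary terms vanish as soon as one argument lies in $G$. Let $\|u\|_a=a(u,u)^{1/2}$ on $H$, $\|v\|_b=b(v,v)^{1/2}$ on $G$, and let $\|T\|_{b,a}$ denote the operator norm of a linear operator $T:(G,\|\cdot\|_b)\to(H,\|\cdot\|_a)$. Let $F_\ell:H^1_0(\mathcal{O}_\ell)\to H$ be defined by $$\int_D\nabla F_\ell v_\ell\cdot\nabla z=\int_{D_\ell}\nabla v_\ell\cdot\nabla z\qquad\text{for all }z\in H,$$ and let $F:G\to H$ be the restricted extension operator $F\{v_\ell\}=\sum_\ell F_\ell v_\ell$. Let $F_{ov}:G\to H$ be defined by $$\int_D\nabla F_{ov}\{v_\ell\}\cdot\nabla z=\sum_\ell\int_{\mathcal{O}_\ell\setminus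 D_\ell}\nabla v_\ell\cdot\nabla z\qquad\text{for all }z\in H,$$ and, for $\epsilon>0$, let $F_\epsilon:G\to H$ be defined by $$a(F_\epsilon\{v_\ell\},z)=c_\epsilon\big(\{v_\ell\},\{z|_{\mathcal{O}_\ell}\}\big)\qquad\text{for all }z\in H.$$ Then $F$, $F_{ov}$ and $F_\epsilon$ (for every $\epsilon>0$) are bounded from $(G,\|\cdot\|_b)$ to $(H,\|\cdot\|_a)$, and $$\|F\|_{b,a}\le 1,\qquad \|F_\epsilon\|_{b,a}\le 1+\epsilon\,\|F_{ov}\|_{b,a}\quad\text{for every }\epsilon>0 .$$ -/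

import Mathlib

open MeasureTheory Filter Topology
open scoped ContDiff

noncomputable section

namespace DomainDecomposition

/-! ### Sobolev spaces on open subsets of Euclidean space -/

/-- Euclidean space `ℝᵈ`. -/
abbrev Pt (d : ℕ) : Type := EuclideanSpace ℝ (Fin d)

/-- `φ ∈ C_c^∞(O)`. -/
def IsTest {d : ℕ} (O : Set (Pt d)) (φ : Pt d → ℝ) : Prop :=
  ContDiff ℝ ∞ φ ∧ HasCompactSupport φ ∧ tsupport φ ⊆ O

/-- `g` is the weak gradient of `u` on `O`: `∫_O u ∂_e φ = - ∫_O (g · e) φ` for all test functions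
`φ` and all directions `e`. -/
def HasWeakGradient {d : ℕ} (O : Set (Pt d)) (u : Pt d → ℝ) (g : Pt d → Pt d) : Prop :=
  ∀ φ : Pt d → ℝ, IsTest O φ → ∀ e : Pt d,
    ∫ x in O, u x * fderiv ℝ φ x e = -∫ x in O, inner ℝ (g x) e * φ x

/-- `L²(O) × L²(O)ᵈ` with the Hilbert norm `(‖u‖² + ‖g‖²)^{1/2}`. -/
abbrev L2Pair {d : ℕ} (O : Set (Pt d)) : Type :=
  WithLp 2 (Lp ℝ 2 (volume.restrict O) × Lp (Pt d) 2 (volume.restrict O))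

theorem IsTest.memLp_fderiv {d : ℕ} {O : Set (Pt d)} {φ : Pt d → ℝ} (h : IsTest O φ) (e : Pt d) :
    MemLp (fun x => fderiv ℝ φ x e) 2 (volume.restrict O) := by
  have hc : Continuous fun x => fderiv ℝ φ x e :=
    (h.1.continuous_fderiv (by simp)).clm_apply continuous_const
  exact (hc.memLp_of_hasCompactSupport (h.2.1.fderiv_apply ℝ e)).restrict O

theorem IsTest.memLp_smul {d : ℕ} {O : Set (Pt d)} {φ : Pt d → ℝ} (h : IsTest O φ) (e : Pt d) :
    MemLp (fun x => φ x • e) 2 (volume.restrict O) := by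
  have hc : Continuous fun x => φ x • e := h.1.continuous.smul continuous_const
  exact (hc.memLp_of_hasCompactSupport h.2.1.smul_right).restrict O

/-- The continuous functional on `L²(O) × L²(O)ᵈ` expressing the weak gradient identity. -/
def weakDefect {d : ℕ} {O : Set (Pt d)} {φ : Pt d → ℝ} (h : IsTest O φ) (e : Pt d) :
    L2Pair O →L[ℝ] ℝ :=
  (innerSL ℝ ((h.memLp_fderiv e).toLp _)).comp
      ((ContinuousLinearMap.fst ℝ _ _).comp
        (WithLp.prodContinuousLinearEquiv 2 ℝ _ _).toContinuousLinearMap) +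
    (innerSL ℝ ((h.memLp_smul e).toLp _)).comp
      ((ContinuousLinearMap.snd ℝ _ _).comp
        (WithLp.prodContinuousLinearEquiv 2 ℝ _ _).toContinuousLinearMap)

theorem weakDefect_apply {d : ℕ} {O : Set (Pt d)} {φ : Pt d → ℝ} (h : IsTest O φ) (e : Pt d)
    (w : L2Pair O) :
    weakDefect h e w =
      (∫ x in O, w.fst x * fderiv ℝ φ x e) + ∫ x in O, inner ℝ (w.snd x) e * φ x := by
  have h1 : inner ℝ ((h.memLp_fderiv e).toLp _) w.fst = ∫ x in O, w.fst x * fderiv ℝ φ x e := by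
    rw [L2.inner_def]
    refine integral_congr_ae ?_
    filter_upwards [(h.memLp_fderiv e).coeFn_toLp] with x hx
    rw [hx]
    simp
  have h2 : inner ℝ ((h.memLp_smul e).toLp _) w.snd = ∫ x in O, inner ℝ (w.snd x) e * φ x := by
    rw [L2.inner_def]
    refine integral_congr_ae ?_
    filter_upwards [(h.memLp_smul e).coeFn_toLp] with x hx
    rw [hx, inner_smul_left, real_inner_comm, mul_comm]
    simp
  rw [← h1, ← h2]
  rfl

theorem hasWeakGradient_iff {d : ℕ} {O : Set (Pt d)} (w : L2Pair O) :
    HasWeakGradient O w.fst w.snd ↔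
      ∀ (φ : Pt d → ℝ) (h : IsTest O φ) (e : Pt d), weakDefect h e w = 0 := by
  simp only [weakDefect_apply, HasWeakGradient, eq_neg_iff_add_eq_zero]

/-- `H¹(O)`, as the space of pairs `(u, ∇u)` of `L²` functions; it carries the usual Hilbert norm
`(‖u‖² + ‖∇u‖²)^{1/2}`. -/
def H1 {d : ℕ} (O : Set (Pt d)) : Submodule ℝ (L2Pair O) where
  carrier := {w | HasWeakGradient O w.fst w.snd}
  add_mem' := by
    intro v w hv hw
    simp only [Set.mem_ofPred_eq, hasWeakGradient_iff] at hv hw ⊢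
    intro φ h e
    rw [map_add, hv φ h e, hw φ h e, add_zero]
  zero_mem' := by
    simp only [Set.mem_ofPred_eq, hasWeakGradient_iff]
    intro φ h e
    exact map_zero _
  smul_mem' := by
    intro c v hv
    simp only [Set.mem_ofPred_eq, hasWeakGradient_iff] at hv ⊢
    intro φ h e
    rw [map_smul, hv φ h e, smul_zero]

/-- The underlying function `u ∈ L²(O)` of an element of `H¹(O)`. -/
def val {d : ℕ} {O : Set (Pt d)} : H1 O →L[ℝ] Lp ℝ 2 (volume.restrict O) :=
  (ContinuousLinearMap.fst ℝ _ _).comp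
    ((WithLp.prodContinuousLinearEquiv 2 ℝ _ _).toContinuousLinearMap.comp (H1 O).subtypeL)

/-- The weak gradient `∇u ∈ L²(O)ᵈ` of an element of `H¹(O)`. -/
def grad {d : ℕ} {O : Set (Pt d)} : H1 O →L[ℝ] Lp (Pt d) 2 (volume.restrict O) :=
  (ContinuousLinearMap.snd ℝ _ _).comp
    ((WithLp.prodContinuousLinearEquiv 2 ℝ _ _).toContinuousLinearMap.comp (H1 O).subtypeL)

theorem norm_sq_eq {d : ℕ} {O : Set (Pt d)} (u : H1 O) : ‖u‖ ^ 2 = ‖val u‖ ^ 2 + ‖grad u‖ ^ 2 :=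
  WithLp.prod_norm_sq_eq_of_L2 (u : L2Pair O)

theorem norm_grad_le {d : ℕ} {O : Set (Pt d)} (u : H1 O) : ‖grad u‖ ≤ ‖u‖ :=
  abs_le_of_sq_le_sq' (by rw [norm_sq_eq]; nlinarith [sq_nonneg ‖val u‖]) (norm_nonneg _) |>.2

theorem isClosed_H1 {d : ℕ} (O : Set (Pt d)) : IsClosed (H1 O : Set (L2Pair O)) := by
  have : (H1 O : Set (L2Pair O)) =
      ⋂ (φ : Pt d → ℝ) (h : IsTest O φ) (e : Pt d), {w | weakDefect h e w = 0} := by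
    ext w
    simp only [Set.mem_iInter, Set.mem_ofPred_eq]
    exact hasWeakGradient_iff w
  rw [this]
  exact isClosed_iInter fun φ => isClosed_iInter fun h => isClosed_iInter fun e =>
    isClosed_eq (weakDefect h e).continuous continuous_const

instance instCompleteH1 {d : ℕ} (O : Set (Pt d)) : CompleteSpace (H1 O) :=
  (isClosed_H1 O).completeSpace_coe

/-- `u ∈ H¹(O)` is (the class of) the test function `φ`. -/
def IsClassOf {d : ℕ} {O : Set (Pt d)} (u : H1 O) (φ : Pt d → ℝ) : Prop :=
  val u =ᵐ[volume.restrict O] φ ∧ grad u =ᵐ[volume.restrict O] gradient φ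

theorem IsTest.add {d : ℕ} {O : Set (Pt d)} {φ ψ : Pt d → ℝ} (hφ : IsTest O φ) (hψ : IsTest O ψ) :
    IsTest O (φ + ψ) :=
  ⟨hφ.1.add hψ.1, hφ.2.1.add hψ.2.1,
    (tsupport_add φ ψ).trans (Set.union_subset hφ.2.2 hψ.2.2)⟩

theorem IsTest.const_smul {d : ℕ} {O : Set (Pt d)} {φ : Pt d → ℝ} (hφ : IsTest O φ) (c : ℝ) :
    IsTest O (c • φ) := by
  refine ⟨hφ.1.const_smul c, ?_, ?_⟩
  · exact hφ.2.1.mono (Function.support_const_smul_subset c φ)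
  · exact (closure_mono (Function.support_const_smul_subset c φ)).trans hφ.2.2

theorem IsTest.differentiable {d : ℕ} {O : Set (Pt d)} {φ : Pt d → ℝ} (hφ : IsTest O φ) :
    Differentiable ℝ φ :=
  hφ.1.differentiable (by simp)

/-- The image of `C_c^∞(O)` in `H¹(O)`. -/
def testClasses {d : ℕ} (O : Set (Pt d)) : Submodule ℝ (H1 O) where
  carrier := {u | ∃ φ : Pt d → ℝ, IsTest O φ ∧ IsClassOf u φ}
  add_mem' := by
    rintro u v ⟨φ, hφ, hu1, hu2⟩ ⟨ψ, hψ, hv1, hv2⟩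
    refine ⟨φ + ψ, hφ.add hψ, ?_, ?_⟩
    · rw [map_add]
      exact (Lp.coeFn_add _ _).trans (hu1.add hv1)
    · rw [map_add]
      refine (Lp.coeFn_add _ _).trans ?_
      filter_upwards [hu2, hv2] with x h1 h2
      simp only [Pi.add_apply, h1, h2, gradient]
      rw [fderiv_add (hφ.differentiable x) (hψ.differentiable x), map_add]
  zero_mem' := by
    refine ⟨0, ⟨contDiff_const, HasCompactSupport.zero, by simp [tsupport]⟩, ?_, ?_⟩
    · rw [map_zero]
      exact Lp.coeFn_zero _ _ _
    · rw [map_zero]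
      refine (Lp.coeFn_zero _ _ _).trans (Eventually.of_forall fun x => ?_)
      simp [gradient]
  smul_mem' := by
    rintro c u ⟨φ, hφ, hu1, hu2⟩
    refine ⟨c • φ, hφ.const_smul c, ?_, ?_⟩
    · rw [map_smul]
      exact (Lp.coeFn_smul _ _).trans (hu1.const_smul c)
    · rw [map_smul]
      refine (Lp.coeFn_smul _ _).trans ?_
      filter_upwards [hu2] with x h1
      simp only [Pi.smul_apply, h1, gradient]
      rw [fderiv_const_smul (hφ.differentiable x)]
      simp

/-- `H¹₀(O)`, the closure of `C_c^∞(O)` in `H¹(O)`. -/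
def H10 {d : ℕ} (O : Set (Pt d)) : Submodule ℝ (H1 O) := (testClasses O).topologicalClosure

instance instCompleteH10 {d : ℕ} (O : Set (Pt d)) : CompleteSpace (H10 O) :=
  (Submodule.isClosed_topologicalClosure _).completeSpace_coe

/-! ### Restriction to a smaller set -/

theorem le_smul_of_subset {d : ℕ} {S O : Set (Pt d)} (h : S ⊆ O) :
    (volume.restrict S : Measure (Pt d)) ≤ (1 : ENNReal) • volume.restrict O := by
  rw [one_smul]
  exact Measure.restrict_mono h le_rfl

/-- Restriction `L²(O) → L²(S)` for `S ⊆ O`. -/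
def restrictL2 {d : ℕ} {V : Type} [NormedAddCommGroup V] [NormedSpace ℝ V] {S O : Set (Pt d)}
    (h : S ⊆ O) : Lp V 2 (volume.restrict O) →L[ℝ] Lp V 2 (volume.restrict S) :=
  Lp.LpToLpOfMeasureLeSMul ENNReal.one_ne_top (le_smul_of_subset h)

theorem IsTest.mono {d : ℕ} {S O : Set (Pt d)} {φ : Pt d → ℝ} (h : IsTest S φ) (hSO : S ⊆ O) :
    IsTest O φ :=
  ⟨h.1, h.2.1, h.2.2.trans hSO⟩

theorem coeFn_restrictL2 {d : ℕ} {V : Type} [NormedAddCommGroup V] [NormedSpace ℝ V]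
    {S O : Set (Pt d)} (h : S ⊆ O) (f : Lp V 2 (volume.restrict O)) :
    restrictL2 h f =ᵐ[volume.restrict S] f :=
  Lp.coeFn_LpToLpOfMeasureLeSMul _ _ f

theorem IsTest.fderiv_eq_zero {d : ℕ} {S : Set (Pt d)} {φ : Pt d → ℝ} (h : IsTest S φ) {x : Pt d}
    (hx : x ∉ S) : fderiv ℝ φ x = 0 :=
  image_eq_zero_of_notMem_tsupport fun hx' => hx (h.2.2 (tsupport_fderiv_subset ℝ hx'))

theorem IsTest.eq_zero {d : ℕ} {S : Set (Pt d)} {φ : Pt d → ℝ} (h : IsTest S φ) {x : Pt d}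
    (hx : x ∉ S) : φ x = 0 :=
  image_eq_zero_of_notMem_tsupport fun hx' => hx (h.2.2 hx')

theorem hasWeakGradient_restrict {d : ℕ} {S O : Set (Pt d)} (h : S ⊆ O) (u : H1 O) :
    HasWeakGradient S (restrictL2 h (val u)) (restrictL2 h (grad u)) := by
  intro φ hφ e
  have h0 : ∀ f : Pt d → ℝ, (∀ x, x ∉ S → f x = 0) → ∫ x in S, f x = ∫ x in O, f x := by
    intro f hf
    rw [setIntegral_eq_integral_of_forall_compl_eq_zero hf,
      setIntegral_eq_integral_of_forall_compl_eq_zero fun x hx => hf x fun h' => hx (h h')]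
  have h1 : ∫ x in S, restrictL2 h (val u) x * fderiv ℝ φ x e =
      ∫ x in S, val u x * fderiv ℝ φ x e := by
    refine integral_congr_ae ?_
    filter_upwards [coeFn_restrictL2 h (val u)] with x hx
    rw [hx]
  have h2 : ∫ x in S, inner ℝ (restrictL2 h (grad u) x) e * φ x =
      ∫ x in S, inner ℝ (grad u x) e * φ x := by
    refine integral_congr_ae ?_
    filter_upwards [coeFn_restrictL2 h (grad u)] with x hx
    rw [hx]
  rw [h1, h2, h0 _ fun x hx => by simp [hφ.fderiv_eq_zero hx],
    h0 _ fun x hx => by simp [hφ.eq_zero hx]]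
  exact u.2 φ (hφ.mono h) e

/-- The restriction `u ↦ u|_S` from `H¹(O)` to `H¹(S)`, for `S ⊆ O`. -/
def restrictH1 {d : ℕ} {S O : Set (Pt d)} (h : S ⊆ O) : H1 O →L[ℝ] H1 S :=
  ((WithLp.prodContinuousLinearEquiv 2 ℝ _ _).symm.toContinuousLinearMap.comp
    (((restrictL2 h).comp val).prod ((restrictL2 h).comp grad))).codRestrict (H1 S)
      (hasWeakGradient_restrict h)

theorem grad_restrictH1 {d : ℕ} {S O : Set (Pt d)} (h : S ⊆ O) (u : H1 O) :
    grad (restrictH1 h u) = restrictL2 h (grad u) := rfl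

/-! ### Boundary traces -/

/-- Surface measure on `∂O`. -/
def surface {d : ℕ} (O : Set (Pt d)) : Measure (Pt d) := μHE[d - 1].restrict (frontier O)

/-- `g ∈ L²(∂O)` is a trace of `u ∈ H¹(O)`: some sequence `φₙ ∈ C_c^∞(ℝᵈ)` converges to `u` in
`H¹(O)` and to `g` in `L²(∂O)`. -/
def IsTrace {d : ℕ} {O : Set (Pt d)} (u : H1 O) (g : Pt d → ℝ) : Prop :=
  MemLp g 2 (surface O) ∧ ∃ φ : ℕ → Pt d → ℝ,
    (∀ n, ContDiff ℝ ∞ (φ n) ∧ HasCompactSupport (φ n)) ∧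
    Tendsto (fun n => eLpNorm (fun x => φ n x - val u x) 2 (volume.restrict O)) atTop (𝓝 0) ∧
    Tendsto (fun n => eLpNorm (fun x => gradient (φ n) x - grad u x) 2 (volume.restrict O))
      atTop (𝓝 0) ∧
    Tendsto (fun n => eLpNorm (fun x => φ n x - g x) 2 (surface O)) atTop (𝓝 0)

open Classical in
/-- The boundary trace of `u ∈ H¹(O)`. On a bounded Lipschitz set every `u` has exactly one trace in
`L²(∂O)`; on a general open set we take the trace of least `L²(∂O)` norm (the traces of `u` form
a closed affine subspace of `L²(∂O)`), and `0` if there is no trace at all. -/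
def trace {d : ℕ} {O : Set (Pt d)} (u : H1 O) : Pt d → ℝ :=
  if h : ∃ g, IsTrace u g ∧
      ∀ g', IsTrace u g' → eLpNorm g 2 (surface O) ≤ eLpNorm g' 2 (surface O)
  then h.choose else 0

theorem isTrace_zero {d : ℕ} {O : Set (Pt d)} (hO : IsOpen O) {u : H1 O} (hu : u ∈ H10 O) :
    IsTrace u 0 := by
  obtain ⟨v, hv, hlim⟩ := mem_closure_iff_seq_limit.1 hu
  choose φ hφ hc using hv
  refine ⟨MemLp.zero, φ, fun n => ⟨(hφ n).1, (hφ n).2.1⟩, ?_, ?_, ?_⟩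
  · have h := ((val (O := O)).continuous.tendsto u).comp hlim
    rw [Lp.tendsto_Lp_iff_tendsto_eLpNorm'] at h
    refine h.congr fun n => eLpNorm_congr_ae ?_
    filter_upwards [(hc n).1] with x hx
    simp [hx]
  · have h := ((grad (O := O)).continuous.tendsto u).comp hlim
    rw [Lp.tendsto_Lp_iff_tendsto_eLpNorm'] at h
    refine h.congr fun n => eLpNorm_congr_ae ?_
    filter_upwards [(hc n).2] with x hx
    simp [hx]
  · refine tendsto_const_nhds.congr fun n => ?_
    have : (fun x => φ n x - (0 : Pt d → ℝ) x) =ᵐ[surface O] 0 := by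
      filter_upwards [ae_restrict_mem isClosed_frontier.measurableSet] with x hx
      have : x ∉ O := fun h => by
        rw [hO.frontier_eq] at hx
        exact hx.2 h
      simp [(hφ n).eq_zero this]
    rw [eLpNorm_congr_ae this, eLpNorm_zero]

theorem trace_ae_zero {d : ℕ} {O : Set (Pt d)} (hO : IsOpen O) {u : H1 O} (hu : u ∈ H10 O) :
    trace u =ᵐ[surface O] 0 := by
  have h : ∃ g, IsTrace u g ∧
      ∀ g', IsTrace u g' → eLpNorm g 2 (surface O) ≤ eLpNorm g' 2 (surface O) :=
    ⟨0, isTrace_zero hO hu, fun g' _ => by simp⟩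
  have h1 : trace u = h.choose := dif_pos h
  rw [h1]
  have h2 := h.choose_spec.2 0 (isTrace_zero hO hu)
  rw [eLpNorm_zero, nonpos_iff_eq_zero,
    eLpNorm_eq_zero_iff h.choose_spec.1.1.aestronglyMeasurable (by simp)] at h2
  exact h2

/-! ### Bilinear forms -/

/-- `∫_S ∇u · ∇v`. -/
def dirichletOn {d : ℕ} {O O' : Set (Pt d)} (S : Set (Pt d)) (u : H1 O) (v : H1 O') : ℝ :=
  ∫ x in S, inner ℝ (grad u x) (grad v x)

/-- `∫_{∂O} u v`. -/
def boundaryForm {d : ℕ} {O : Set (Pt d)} (u v : H1 O) : ℝ :=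
  ∫ x, trace u x * trace v x ∂(surface O)

theorem boundaryForm_eq_zero {d : ℕ} {O : Set (Pt d)} (hO : IsOpen O) {u : H1 O} (hu : u ∈ H10 O)
    (v : H1 O) : boundaryForm u v = 0 := by
  refine integral_eq_zero_of_ae ?_
  filter_upwards [trace_ae_zero hO hu] with x hx
  simp [hx]

theorem inner_restrictL2 {d : ℕ} {O O' S : Set (Pt d)} (h : S ⊆ O) (h' : S ⊆ O') (u : H1 O)
    (v : H1 O') : inner ℝ (restrictL2 h (grad u)) (restrictL2 h' (grad v)) = dirichletOn S u v := by
  rw [L2.inner_def]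
  refine integral_congr_ae ?_
  filter_upwards [coeFn_restrictL2 h (grad u), coeFn_restrictL2 h' (grad v)] with x h1 h2
  rw [h1, h2]

/-- `dirichletOn S` as a bilinear form on `H¹₀(O) × H¹₀(O')`. -/
def dirichletBilin {d : ℕ} {O O' S : Set (Pt d)} (h : S ⊆ O) (h' : S ⊆ O') :
    H10 O →ₗ[ℝ] H10 O' →ₗ[ℝ] ℝ :=
  LinearMap.mk₂ ℝ (fun u v => dirichletOn S u.1 v.1)
    (fun u₁ u₂ v => by
      simp only [← inner_restrictL2 h h', Submodule.coe_add, map_add, inner_add_left])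
    (fun r u v => by
      simp only [← inner_restrictL2 h h', Submodule.coe_smul, map_smul, real_inner_smul_left, smul_eq_mul])
    (fun u v₁ v₂ => by
      simp only [← inner_restrictL2 h h', Submodule.coe_add, map_add, inner_add_right])
    (fun r u v => by
      simp only [← inner_restrictL2 h h', Submodule.coe_smul, map_smul, real_inner_smul_right, smul_eq_mul])

theorem dirichletBilin_apply {d : ℕ} {O O' S : Set (Pt d)} (h : S ⊆ O) (h' : S ⊆ O') (u : H10 O)
    (v : H10 O') : dirichletBilin h h' u v = dirichletOn S u.1 v.1 := rfl

theorem dirichletOn_le {d : ℕ} {O O' S : Set (Pt d)} (h : S ⊆ O) (h' : S ⊆ O') :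
    ∃ K, ∀ (u : H1 O) (v : H1 O'), |dirichletOn S u v| ≤ K * ‖u‖ * ‖v‖ := by
  refine ⟨‖(restrictL2 h : Lp (Pt d) 2 (volume.restrict O) →L[ℝ] _)‖ *
    ‖(restrictL2 h' : Lp (Pt d) 2 (volume.restrict O') →L[ℝ] _)‖, fun u v => ?_⟩
  have h1 := ((restrictL2 h).le_opNorm (grad u)).trans
    (mul_le_mul_of_nonneg_left (norm_grad_le u) (norm_nonneg _))
  have h2 := ((restrictL2 h').le_opNorm (grad v)).trans
    (mul_le_mul_of_nonneg_left (norm_grad_le v) (norm_nonneg _))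
  rw [← inner_restrictL2 h h']
  refine (abs_real_inner_le_norm _ _).trans ((mul_le_mul h1 h2 (norm_nonneg _) (by positivity)).trans
    (le_of_eq (by ring)))

theorem dirichletOn_self {d : ℕ} {O : Set (Pt d)} (u : H1 O) :
    dirichletOn O u u = ‖grad u‖ ^ 2 := by
  rw [← real_inner_self_eq_norm_sq, L2.inner_def, dirichletOn]

theorem dirichletOn_restrict {d : ℕ} {O O' S P : Set (Pt d)} (hP : S ⊆ P) (h : P ⊆ O')
    (u : H1 O) (v : H1 O') : dirichletOn S u (restrictH1 h v) = dirichletOn S u v := by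
  refine integral_congr_ae ?_
  rw [grad_restrictH1]
  filter_upwards [ae_restrict_of_ae_restrict_of_subset hP (coeFn_restrictL2 h (grad v))] with x hx
  rw [hx]

/-! ### The Friedrichs inequality and the variational problem on `H¹₀(D)` -/

theorem integrable_sq_norm {V W : Type*} [NormedAddCommGroup V] [InnerProductSpace ℝ V]
    [FiniteDimensional ℝ V] [MeasurableSpace V] [BorelSpace V] [NormedAddCommGroup W] {f : V → W}
    (hf : Continuous f) (hs : HasCompactSupport f) : Integrable fun x => ‖f x‖ ^ 2 := by
  have h1 : HasCompactSupport fun x => ‖f x‖ ^ 2 :=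
    hs.norm.comp_left (g := fun t : ℝ => t ^ 2) (by simp)
  exact (hf.norm.pow 2).integrable_of_hasCompactSupport h1

theorem friedrichs_aux {V : Type*} [NormedAddCommGroup V] [InnerProductSpace ℝ V]
    [FiniteDimensional ℝ V] [MeasurableSpace V] [BorelSpace V] {D : Set V} {M : ℝ}
    (hM : ∀ x ∈ D, ‖x‖ ≤ M) (e : V) (p : V →L[ℝ] ℝ) (hpe : p e = 1) (hne : ‖e‖ = 1)
    (hp : ∀ x, |p x| ≤ ‖x‖) {φ : V → ℝ} (hφ : ContDiff ℝ ∞ φ) (hφs : HasCompactSupport φ)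
    (hD : ∀ x, x ∉ D → φ x = 0) :
    ∫ x, φ x ^ 2 ≤ 4 * M ^ 2 * ∫ x, ‖fderiv ℝ φ x‖ ^ 2 := by
  have hφd : Differentiable ℝ φ := hφ.differentiable (by simp)
  have hφc := hφ.continuous
  have hfc : Continuous fun x => fderiv ℝ φ x := hφ.continuous_fderiv (by simp)
  have hfs : HasCompactSupport fun x => fderiv ℝ φ x := hφs.fderiv ℝ
  have hsq : ∀ x, fderiv ℝ (fun y => φ y ^ 2) x e = 2 * φ x * fderiv ℝ φ x e := fun x => by
    rw [((hφd x).hasFDerivAt.pow 2).fderiv]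
    simp
  have hs2 : HasCompactSupport fun x => φ x ^ 2 := hφs.comp_left (g := fun t => t ^ 2) (by simp)
  have i1 : Integrable fun x => φ x ^ 2 := (hφc.pow 2).integrable_of_hasCompactSupport hs2
  have i2 : Integrable fun x => ‖fderiv ℝ φ x‖ ^ 2 := integrable_sq_norm hfc hfs
  have i3 : Integrable fun x => p x * fderiv ℝ (fun y => φ y ^ 2) x e := by
    simp only [hsq]
    refine (p.continuous.mul ((continuous_const.mul hφc).mul
      (hfc.clm_apply continuous_const))).integrable_of_hasCompactSupport ?_
    exact (hφs.mul_left.mul_right).mul_left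
  have i4 : Integrable fun x => p x * φ x ^ 2 :=
    (p.continuous.mul (hφc.pow 2)).integrable_of_hasCompactSupport hs2.mul_left
  have hpd : ∀ x, fderiv ℝ (fun y => p y) x e = 1 := fun x => by
    rw [p.fderiv, hpe]
  have key := integral_mul_fderiv_eq_neg_fderiv_mul_of_integrable (μ := volume)
    (f := fun y => p y) (g := fun y => φ y ^ 2) (v := e)
    (by simpa only [hpd, one_mul] using i1) i3 i4
    (fun x _ => p.differentiableAt) (fun x _ => (hφd x).pow 2)
  simp only [hpd, one_mul] at key
  have hpt : ∀ x, -(p x * fderiv ℝ (fun y => φ y ^ 2) x e) ≤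
      (1 / 2) * φ x ^ 2 + 2 * M ^ 2 * ‖fderiv ℝ φ x‖ ^ 2 := by
    intro x
    by_cases hx : x ∈ D
    · have h1 : |p x| ≤ M := (hp x).trans (hM x hx)
      have h2 : |fderiv ℝ φ x e| ≤ ‖fderiv ℝ φ x‖ := by
        simpa [hne] using (fderiv ℝ φ x).le_opNorm e
      have h3 : |p x * fderiv ℝ φ x e| ≤ M * ‖fderiv ℝ φ x‖ := by
        rw [abs_mul]
        exact mul_le_mul h1 h2 (abs_nonneg _) ((abs_nonneg _).trans h1)
      have h4 : (p x * fderiv ℝ φ x e) ^ 2 ≤ (M * ‖fderiv ℝ φ x‖) ^ 2 :=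
        sq_le_sq' (by linarith [neg_abs_le (p x * fderiv ℝ φ x e)]) ((le_abs_self _).trans h3)
      rw [hsq]
      nlinarith [sq_nonneg (φ x + 2 * (p x * fderiv ℝ φ x e))]
    · rw [hsq, hD x hx]
      simp only [mul_zero, zero_mul, neg_zero]
      positivity
  have hint := integral_mono i3.neg ((i1.const_mul (1 / 2)).add (i2.const_mul (2 * M ^ 2))) hpt
  simp only [Pi.neg_apply, Pi.add_apply] at hint
  rw [integral_neg, integral_add (i1.const_mul _) (i2.const_mul _), integral_const_mul,
    integral_const_mul, key] at hint
  linarith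

theorem friedrichs_test {d : ℕ} (hd : 0 < d) {D : Set (Pt d)} {M : ℝ}
    (hM : ∀ x ∈ D, ‖x‖ ≤ M) {φ : Pt d → ℝ} (hφ : IsTest D φ) :
    ∫ x in D, φ x ^ 2 ≤ 4 * M ^ 2 * ∫ x in D, ‖gradient φ x‖ ^ 2 := by
  have hng : ∀ x, ‖gradient φ x‖ = ‖fderiv ℝ φ x‖ := fun x => by simp [gradient]
  simp only [hng]
  rw [setIntegral_eq_integral_of_forall_compl_eq_zero fun x hx => by simp [hφ.eq_zero hx],
    setIntegral_eq_integral_of_forall_compl_eq_zero fun x hx => by simp [hφ.fderiv_eq_zero hx]]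
  obtain ⟨e, p, hpe, hne, hp⟩ : ∃ (e : Pt d) (p : Pt d →L[ℝ] ℝ),
      p e = 1 ∧ ‖e‖ = 1 ∧ ∀ x, |p x| ≤ ‖x‖ :=
    ⟨EuclideanSpace.single ⟨0, hd⟩ 1, EuclideanSpace.proj ⟨0, hd⟩, by simp, by simp,
      fun x => PiLp.norm_apply_le x _⟩
  exact friedrichs_aux hM e p hpe hne hp hφ.1 hφ.2.1 fun x hx => hφ.eq_zero hx

theorem friedrichs {d : ℕ} (hd : 0 < d) {D : Set (Pt d)} {M : ℝ} (hM : ∀ x ∈ D, ‖x‖ ≤ M)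
    {u : H1 D} (hu : u ∈ H10 D) : ‖val u‖ ^ 2 ≤ 4 * M ^ 2 * ‖grad u‖ ^ 2 := by
  have hcl : IsClosed {u : H1 D | ‖val u‖ ^ 2 ≤ 4 * M ^ 2 * ‖grad u‖ ^ 2} :=
    isClosed_le (by fun_prop) (by fun_prop)
  refine closure_minimal ?_ hcl hu
  rintro v ⟨φ, hφ, h1, h2⟩
  have e1 : ‖val v‖ ^ 2 = ∫ x in D, φ x ^ 2 := by
    rw [← real_inner_self_eq_norm_sq, L2.inner_def]
    refine integral_congr_ae ?_
    filter_upwards [h1] with x hx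
    rw [hx, real_inner_self_eq_norm_sq, Real.norm_eq_abs, sq_abs]
  have e2 : ‖grad v‖ ^ 2 = ∫ x in D, ‖gradient φ x‖ ^ 2 := by
    rw [← real_inner_self_eq_norm_sq, L2.inner_def]
    refine integral_congr_ae ?_
    filter_upwards [h2] with x hx
    rw [hx, real_inner_self_eq_norm_sq]
  rw [Set.mem_ofPred_eq, e1, e2]
  exact friedrichs_test hd hM hφ

/-- The Lax–Milgram lemma, for a family of right-hand sides depending linearly on `x`. -/
theorem existsUnique_of_coercive {V X : Type*} [NormedAddCommGroup V] [InnerProductSpace ℝ V]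
    [CompleteSpace V] [AddCommGroup X] [Module ℝ X] (A : V →ₗ[ℝ] V →ₗ[ℝ] ℝ) {C K : ℝ} (hC : 0 < C)
    (hA : ∀ u, C * ‖u‖ ^ 2 ≤ A u u) (hK : ∀ u v, |A u v| ≤ K * ‖u‖ * ‖v‖) (B : X →ₗ[ℝ] V →ₗ[ℝ] ℝ)
    (hB : ∀ x, ∃ L, ∀ z, |B x z| ≤ L * ‖z‖) :
    ∃! T : X →ₗ[ℝ] V, ∀ x z, A (T x) z = B x z := by
  let A' : V →L[ℝ] V →L[ℝ] ℝ := A.mkContinuous₂ K hK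
  have hA' : ∀ u v, A' u v = A u v := fun u v => rfl
  have hco : IsCoercive A' := ⟨C, hC, fun u => by rw [mul_assoc, ← sq]; exact hA u⟩
  choose L hL using hB
  let B' : X →ₗ[ℝ] (V →L[ℝ] ℝ) :=
    { toFun := fun x => (B x).mkContinuous (L x) (hL x)
      map_add' := fun x y => by ext z; simp
      map_smul' := fun r x => by ext z; simp }
  have hB' : ∀ x z, B' x z = B x z := fun x z => rfl
  let e := hco.continuousLinearEquivOfBilin
  have he : ∀ u v, inner ℝ (e u) v = A' u v := hco.continuousLinearEquivOfBilin_apply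
  refine ⟨e.symm.toLinearEquiv.toLinearMap ∘ₗ
    (InnerProductSpace.toDual ℝ V).symm.toLinearEquiv.toLinearMap ∘ₗ B', ?_, ?_⟩
  · intro x z
    rw [← hA', ← he, ← hB']
    simp
  · intro T hT
    ext1 x
    refine e.injective (ext_inner_right ℝ fun z => ?_)
    rw [he, hA', hT, ← hB']
    simp

theorem add_smul_apply_apply {X V : Type*} [AddCommGroup X] [Module ℝ X] [AddCommGroup V]
    [Module ℝ V] (B₁ B₂ : X →ₗ[ℝ] V →ₗ[ℝ] ℝ) (ε : ℝ) (x : X) (z : V) :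
    (B₁ + ε • B₂) x z = B₁ x z + ε * B₂ x z := rfl

theorem add_smul_le {X V : Type*} [AddCommGroup X] [Module ℝ X] [AddCommGroup V] [Module ℝ V]
    {B₁ B₂ : X →ₗ[ℝ] V →ₗ[ℝ] ℝ} {n : V → ℝ} (h₁ : ∀ x, ∃ L, ∀ z, |B₁ x z| ≤ L * n z)
    (h₂ : ∀ x, ∃ L, ∀ z, |B₂ x z| ≤ L * n z) (ε : ℝ) (x : X) :
    ∃ L, ∀ z, |(B₁ + ε • B₂) x z| ≤ L * n z := by
  obtain ⟨L₁, h₁⟩ := h₁ x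
  obtain ⟨L₂, h₂⟩ := h₂ x
  refine ⟨L₁ + |ε| * L₂, fun z => ?_⟩
  rw [add_smul_apply_apply, add_mul, mul_assoc]
  refine (abs_add_le _ _).trans (add_le_add (h₁ z) ?_)
  rw [abs_mul]
  exact mul_le_mul_of_nonneg_left (h₂ z) (abs_nonneg ε)

/-- If a form `B` on `X × H¹₀(D)` is linear in the first and bounded linear in the second variable,
there is a unique linear `T : X → H¹₀(D)` with `∫_D ∇(T x) · ∇z = B(x, z)` for all `z`. -/
theorem existsUnique_lift {d : ℕ} (hd : 0 < d) {D : Set (Pt d)} (hD : Bornology.IsBounded D)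
    {X : Type*} [AddCommGroup X] [Module ℝ X] (B : X →ₗ[ℝ] H10 D →ₗ[ℝ] ℝ)
    (hB : ∀ x, ∃ L, ∀ z, |B x z| ≤ L * ‖z.1‖) :
    ∃! T : X →ₗ[ℝ] H10 D, ∀ x z, dirichletOn D (T x).1 z.1 = B x z := by
  refine hD.exists_norm_le.elim fun M hM => ?_
  refine (dirichletOn_le (Set.Subset.refl D) (Set.Subset.refl D)).elim fun K hK => ?_
  have hco : ∀ u : H10 D, (4 * M ^ 2 + 1)⁻¹ * ‖u‖ ^ 2 ≤
      dirichletBilin (Set.Subset.refl D) (Set.Subset.refl D) u u := fun u => by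
    have h1 := friedrichs hd hM u.2
    have h2 := norm_sq_eq u.1
    rw [dirichletBilin_apply, dirichletOn_self, inv_mul_le_iff₀ (by positivity),
      ← Submodule.norm_coe, h2]
    linarith
  exact existsUnique_of_coercive (V := H10 D) (dirichletBilin (Set.Subset.refl D)
    (Set.Subset.refl D)) (by positivity) hco (fun u v => hK u.1 v.1) B hB

/-! ### Overlapping decompositions and the operators `F`, `F_ε`, `F_ov` -/

/-- A bounded open set `D ⊆ ℝᵈ`, `d ≥ 1`, with a non-overlapping partition into open sets
`D_ℓ` and an overlapping decomposition into open sets `O_ℓ` with `D_ℓ ⊆ O_ℓ ⊆ D`. -/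
structure Decomposition (d : ℕ) (ι : Type*) where
  /-- the domain `D` -/
  D : Set (Pt d)
  /-- the non-overlapping subdomains `D_ℓ` -/
  sub : ι → Set (Pt d)
  /-- the overlapping subdomains `O_ℓ` -/
  ov : ι → Set (Pt d)
  dim_pos : 0 < d
  isOpen_D : IsOpen D
  isBounded_D : Bornology.IsBounded D
  isOpen_sub : ∀ l, IsOpen (sub l)
  disjoint_sub : Pairwise fun k l => Disjoint (sub k) (sub l)
  cover : D ⊆ ⋃ l, closure (sub l)
  isOpen_ov : ∀ l, IsOpen (ov l)
  sub_subset_ov : ∀ l, sub l ⊆ ov l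
  ov_subset_D : ∀ l, ov l ⊆ D

namespace Decomposition

variable {d : ℕ} {ι : Type*} (P : Decomposition d ι)

/-- `H = H¹₀(D)`. -/
abbrev H : Type := H10 P.D

/-- `Ĝ = ∏ H¹(O_ℓ)`. -/
abbrev Ghat : Type _ := (l : ι) → H1 (P.ov l)

/-- `G = ∏ H¹₀(O_ℓ) ⊆ Ĝ`. -/
def G : Submodule ℝ P.Ghat := Submodule.pi Set.univ fun l => H10 (P.ov l)

/-- The component `v_ℓ ∈ H¹₀(O_ℓ)` of `{v_ℓ} ∈ G`. -/
def comp (l : ι) : P.G →ₗ[ℝ] H10 (P.ov l) where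
  toFun v := ⟨v.1 l, v.2 l (Set.mem_univ l)⟩
  map_add' _ _ := rfl
  map_smul' _ _ := rfl

/-- `a(u, v) = ∫_D ∇u · ∇v`. -/
def a (u v : P.H) : ℝ := dirichletOn P.D u.1 v.1

theorem sub_subset_D (l : ι) : P.sub l ⊆ P.D := (P.sub_subset_ov l).trans (P.ov_subset_D l)

theorem diff_subset_ov (l : ι) : P.ov l \ P.sub l ⊆ P.ov l := Set.sdiff_subset

theorem diff_subset_D (l : ι) : P.ov l \ P.sub l ⊆ P.D :=
  (P.diff_subset_ov l).trans (P.ov_subset_D l)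

theorem existsUnique_Floc (l : ι) : ∃! T : H10 (P.ov l) →ₗ[ℝ] P.H,
    ∀ v z, P.a (T v) z = dirichletOn (P.sub l) v.1 z.1 := by
  refine (dirichletOn_le (P.sub_subset_ov l) (P.sub_subset_D l)).elim fun K hK => ?_
  exact existsUnique_lift P.dim_pos P.isBounded_D
    (dirichletBilin (P.sub_subset_ov l) (P.sub_subset_D l))
    fun v => ⟨K * ‖v.1‖, fun z => hK v.1 z.1⟩

/-- `F_ℓ : H¹₀(O_ℓ) → H`, the solution operator of
`∫_D ∇(F_ℓ v) · ∇z = ∫_{D_ℓ} ∇v · ∇z` for all `z ∈ H`. -/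
def Floc (l : ι) : H10 (P.ov l) →ₗ[ℝ] P.H := (P.existsUnique_Floc l).choose

theorem a_Floc (l : ι) (v : H10 (P.ov l)) (z : P.H) :
    P.a (P.Floc l v) z = dirichletOn (P.sub l) v.1 z.1 :=
  (P.existsUnique_Floc l).choose_spec.1 v z

variable [Fintype ι]

/-- `b(v, w) = ∑ (∫_{O_ℓ} ∇v_ℓ · ∇w_ℓ + ∫_{∂O_ℓ} v_ℓ w_ℓ)`. -/
def b (v w : P.Ghat) : ℝ :=
  ∑ l, (dirichletOn (P.ov l) (v l) (w l) + boundaryForm (v l) (w l))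

/-- `c_ε(v, w) = ∑ ∫_{D_ℓ} ∇v_ℓ · ∇w_ℓ + ε ∑ ∫_{O_ℓ ∖ D_ℓ} ∇v_ℓ · ∇w_ℓ + ∑ ∫_{∂O_ℓ} v_ℓ w_ℓ`. -/
def c (ε : ℝ) (v w : P.Ghat) : ℝ :=
  ∑ l, dirichletOn (P.sub l) (v l) (w l) + ε * ∑ l, dirichletOn (P.ov l \ P.sub l) (v l) (w l) +
    ∑ l, boundaryForm (v l) (w l)

/-- The norm `‖u‖_a = a(u, u)^{1/2}` on `H`. -/
def normA (u : P.H) : ℝ := √(P.a u u)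

/-- The norm `‖v‖_b = b(v, v)^{1/2}`. -/
def normB (v : P.Ghat) : ℝ := √(P.b v v)

/-- The restriction operator `R u = {u|_{O_ℓ}}` from `H` to `Ĝ`. -/
def R (u : P.H) : P.Ghat := fun l => restrictH1 (P.ov_subset_D l) u.1

/-- The restricted extension operator `F {v_ℓ} = ∑ F_ℓ v_ℓ`. -/
def F : P.G →ₗ[ℝ] P.H := ∑ l, P.Floc l ∘ₗ P.comp l

/-- `(v, z) ↦ ∑ ∫_{S_ℓ} ∇v_ℓ · ∇z` on `G × H`. -/
def sumBilin {S : ι → Set (Pt d)} (h : ∀ l, S l ⊆ P.ov l) : P.G →ₗ[ℝ] P.H →ₗ[ℝ] ℝ :=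
  ∑ l, dirichletBilin (h l) ((h l).trans (P.ov_subset_D l)) ∘ₗ P.comp l

theorem sumBilin_apply {S : ι → Set (Pt d)} (h : ∀ l, S l ⊆ P.ov l) (v : P.G) (z : P.H) :
    P.sumBilin h v z = ∑ l, dirichletOn (S l) (v.1 l) z.1 := by
  simp only [sumBilin, LinearMap.sum_apply]
  rfl

theorem sumBilin_le {S : ι → Set (Pt d)} (h : ∀ l, S l ⊆ P.ov l) (v : P.G) :
    ∃ L, ∀ z, |P.sumBilin h v z| ≤ L * ‖z.1‖ := by
  choose K hK using fun l => dirichletOn_le (h l) ((h l).trans (P.ov_subset_D l))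
  refine ⟨∑ l, K l * ‖v.1 l‖, fun z => ?_⟩
  rw [sumBilin_apply, Finset.sum_mul]
  exact (Finset.abs_sum_le_sum_abs _ _).trans (Finset.sum_le_sum fun l _ => hK l _ _)

theorem existsUnique_Fov : ∃! T : P.G →ₗ[ℝ] P.H,
    ∀ v z, P.a (T v) z = ∑ l, dirichletOn (P.ov l \ P.sub l) (v.1 l) z.1 := by
  simp only [← P.sumBilin_apply P.diff_subset_ov]
  exact existsUnique_lift P.dim_pos P.isBounded_D _ (P.sumBilin_le P.diff_subset_ov)

/-- `F_ov : G → H`, the solution operator of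
`∫_D ∇(F_ov v) · ∇z = ∑ ∫_{O_ℓ ∖ D_ℓ} ∇v_ℓ · ∇z` for all `z ∈ H`. -/
def Fov : P.G →ₗ[ℝ] P.H := P.existsUnique_Fov.choose

theorem a_Fov (v : P.G) (z : P.H) :
    P.a (P.Fov v) z = ∑ l, dirichletOn (P.ov l \ P.sub l) (v.1 l) z.1 :=
  P.existsUnique_Fov.choose_spec.1 v z

theorem c_R (ε : ℝ) (v : P.G) (z : P.H) :
    P.c ε v.1 (P.R z) = ∑ l, dirichletOn (P.sub l) (v.1 l) z.1 +
      ε * ∑ l, dirichletOn (P.ov l \ P.sub l) (v.1 l) z.1 := by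
  have h : ∀ l, boundaryForm (v.1 l) (P.R z l) = 0 := fun l =>
    boundaryForm_eq_zero (P.isOpen_ov l) (v.2 l (Set.mem_univ l)) _
  simp only [c, h, Finset.sum_const_zero, add_zero]
  congr 1
  · exact Finset.sum_congr rfl fun l _ => dirichletOn_restrict (P.sub_subset_ov l) _ _ _
  · congr 1
    exact Finset.sum_congr rfl fun l _ => dirichletOn_restrict (P.diff_subset_ov l) _ _ _

theorem existsUnique_Feps (ε : ℝ) : ∃! T : P.G →ₗ[ℝ] P.H,
    ∀ v z, P.a (T v) z = P.c ε v.1 (P.R z) := by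
  simp only [c_R, ← P.sumBilin_apply P.sub_subset_ov, ← P.sumBilin_apply P.diff_subset_ov,
    ← add_smul_apply_apply]
  exact existsUnique_lift P.dim_pos P.isBounded_D _
    (add_smul_le (P.sumBilin_le P.sub_subset_ov) (P.sumBilin_le P.diff_subset_ov) ε)

/-- `F_ε = R^{T,c_ε}|_G`: the operator `G → H` with `a(F_ε v, z) = c_ε(v, R z)` for all
`v ∈ G`, `z ∈ H`. -/
def Feps (ε : ℝ) : P.G →ₗ[ℝ] P.H := (P.existsUnique_Feps ε).choose

theorem a_Feps (ε : ℝ) (v : P.G) (z : P.H) : P.a (P.Feps ε v) z = P.c ε v.1 (P.R z) :=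
  (P.existsUnique_Feps ε).choose_spec.1 v z

/-- `C` is a bound for `T` from the `b`-norm to the `a`-norm. -/
def IsBoundFor (T : P.G →ₗ[ℝ] P.H) (C : ℝ) : Prop :=
  0 ≤ C ∧ ∀ v : P.G, P.normA (T v) ≤ C * P.normB v.1

/-- `T` is bounded from `(G, ‖·‖_b)` to `(H, ‖·‖_a)`. -/
def IsBoundedBA (T : P.G →ₗ[ℝ] P.H) : Prop := ∃ C, P.IsBoundFor T C

/-- The operator norm `‖T‖_{b,a}` of a bounded operator `T : (G, ‖·‖_b) → (H, ‖·‖_a)`. -/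
def opNormBA (T : P.G →ₗ[ℝ] P.H) : ℝ := sInf {C | P.IsBoundFor T C}

end Decomposition

end DomainDecomposition

end

/-!
All three operators solve `a(T v, z) = f_v(z)` for all `z ∈ H`, where `f_v` is a combination of the
functionals `z ↦ ∑ ∫_{S_ℓ} ∇v_ℓ · ∇z` with `S_ℓ ⊆ O_ℓ`. Testing with `z = T v` and applying the
Cauchy–Schwarz inequality first on each `S_ℓ` and then to the sum over `ℓ` gives
`‖T v‖_a² ≤ ‖v‖_b (∑ ∫_{S_ℓ} |∇(T v)|²)^{1/2}`, because the boundary terms of `‖v‖_b` vanish on `G`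
(`Decomposition.isBoundFor_of_sum_dirichletOn_le`). What remains is to bound
`∑ ∫_{S_ℓ} |∇z|²` by a multiple of `‖z‖_a²`: for `S_ℓ = D_ℓ` the constant is `1` by disjointness,
which is the bound for `F`; for `S_ℓ = O_ℓ ∖ D_ℓ` the number of subdomains is a constant, so that
`F_ov` is bounded.

Since the boundary terms of `c_ε` vanish on `G` as well, uniqueness of the solution operators gives
`F_ε = F + ε F_ov`, and the bound for `F_ε` is the triangle inequality.
-/

namespace DomainDecomposition

theorem le_mul_of_sq_le_mul {p q s C : ℝ} (hp : 0 ≤ p) (hq : 0 ≤ q) (hC : 0 ≤ C)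
    (h : p ^ 2 ≤ q * s) (hs : s ≤ C * p) : p ≤ C * q := by
  have h1 := mul_le_mul_of_nonneg_left hs hq
  rcases hp.eq_or_lt with h0 | h0
  · rw [← h0]
    exact mul_nonneg hC hq
  · exact le_of_mul_le_mul_right (by linarith) h0

theorem integrableOn_inner_grad_self {d : ℕ} {O S : Set (Pt d)} (h : S ⊆ O) (u : H1 O) :
    IntegrableOn (fun x => inner ℝ (grad u x) (grad u x)) S volume :=
  IntegrableOn.mono_set (L2.integrable_inner (𝕜 := ℝ) (grad u) (grad u)) h

theorem dirichletOn_self_nonneg {d : ℕ} {O S : Set (Pt d)} (u : H1 O) : 0 ≤ dirichletOn S u u :=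
  integral_nonneg fun _ => real_inner_self_nonneg

theorem dirichletOn_self_mono {d : ℕ} {O S : Set (Pt d)} (h : S ⊆ O) (u : H1 O) :
    dirichletOn S u u ≤ dirichletOn O u u :=
  setIntegral_mono_set (integrableOn_inner_grad_self (Set.Subset.refl O) u)
    (Eventually.of_forall fun _ => real_inner_self_nonneg) h.eventuallyLE

theorem dirichletOn_le_sqrt_mul_sqrt {d : ℕ} {O O' S : Set (Pt d)} (h : S ⊆ O) (h' : S ⊆ O')
    (u : H1 O) (v : H1 O') :
    dirichletOn S u v ≤ √(dirichletOn S u u) * √(dirichletOn S v v) := by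
  rw [← inner_restrictL2 h h', ← inner_restrictL2 h h, ← inner_restrictL2 h' h',
    ← norm_eq_sqrt_real_inner, ← norm_eq_sqrt_real_inner]
  exact real_inner_le_norm _ _

namespace Decomposition

variable {d : ℕ} {ι : Type*} (P : Decomposition d ι)

theorem normA_eq_norm_grad (u : P.H) : P.normA u = ‖grad u.1‖ := by
  rw [normA, a, dirichletOn_self, Real.sqrt_sq (norm_nonneg _)]

theorem normA_nonneg (u : P.H) : 0 ≤ P.normA u := Real.sqrt_nonneg _

theorem normA_sq (u : P.H) : P.normA u ^ 2 = P.a u u := by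
  exact Real.sq_sqrt (dirichletOn_self_nonneg u.1)

theorem normA_add_smul_le (u v : P.H) {r : ℝ} (hr : 0 ≤ r) :
    P.normA (u + r • v) ≤ P.normA u + r * P.normA v := by
  simp only [normA_eq_norm_grad, Submodule.coe_add, Submodule.coe_smul, map_add, map_smul]
  refine (norm_add_le _ _).trans (le_of_eq ?_)
  rw [norm_smul, Real.norm_of_nonneg hr]

theorem a_add_smul (u v z : P.H) (r : ℝ) : P.a (u + r • v) z = P.a u z + r * P.a v z := by
  simp only [a, ← dirichletBilin_apply (Set.Subset.refl P.D) (Set.Subset.refl P.D)]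
  simp

variable [Fintype ι]

theorem normB_nonneg (v : P.Ghat) : 0 ≤ P.normB v := Real.sqrt_nonneg _

theorem b_self (v : P.G) : P.b v.1 v.1 = ∑ l, dirichletOn (P.ov l) (v.1 l) (v.1 l) := by
  refine Finset.sum_congr rfl fun l _ => ?_
  rw [boundaryForm_eq_zero (P.isOpen_ov l) (v.2 l (Set.mem_univ l)), add_zero]

theorem sum_dirichletOn_le {S : ι → Set (Pt d)} (h : ∀ l, S l ⊆ P.ov l) (v : P.G) (z : P.H) :
    ∑ l, dirichletOn (S l) (v.1 l) z.1 ≤ P.normB v.1 * √(∑ l, dirichletOn (S l) z.1 z.1) := by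
  have h1 : ∀ l, dirichletOn (S l) (v.1 l) z.1 ≤
      √(dirichletOn (S l) (v.1 l) (v.1 l)) * √(dirichletOn (S l) z.1 z.1) := fun l =>
    dirichletOn_le_sqrt_mul_sqrt (h l) ((h l).trans (P.ov_subset_D l)) (v.1 l) z.1
  have h2 : ∑ l, dirichletOn (S l) (v.1 l) (v.1 l) ≤ P.b v.1 v.1 := by
    rw [b_self]
    exact Finset.sum_le_sum fun l _ => dirichletOn_self_mono (h l) (v.1 l)
  refine (Finset.sum_le_sum fun l _ => h1 l).trans ((Real.sum_sqrt_mul_sqrt_le Finset.univ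
    (f := fun l => dirichletOn (S l) (v.1 l) (v.1 l)) (g := fun l => dirichletOn (S l) z.1 z.1)
    (fun l => dirichletOn_self_nonneg (v.1 l)) fun l => dirichletOn_self_nonneg z.1).trans ?_)
  exact mul_le_mul_of_nonneg_right (Real.sqrt_le_sqrt h2) (Real.sqrt_nonneg _)

/-- The case `z = T v` of this estimate bounds a solution operator `T` whose right-hand side lives on
sets `S_ℓ ⊆ O_ℓ`. -/
theorem normA_le_of_sum_dirichletOn_le {S : ι → Set (Pt d)} (h : ∀ l, S l ⊆ P.ov l) {C : ℝ}
    (hC : 0 ≤ C) (v : P.G) (z : P.H) (hz : P.a z z = ∑ l, dirichletOn (S l) (v.1 l) z.1)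
    (hS : ∑ l, dirichletOn (S l) z.1 z.1 ≤ C ^ 2 * P.a z z) :
    P.normA z ≤ C * P.normB v.1 := by
  have h1 := hz.trans_le (P.sum_dirichletOn_le h v z)
  have h2 : √(∑ l, dirichletOn (S l) z.1 z.1) ≤ C * P.normA z := by
    refine Real.sqrt_le_iff.2 ⟨mul_nonneg hC (P.normA_nonneg z), ?_⟩
    rwa [mul_pow, normA_sq]
  rw [← normA_sq] at h1
  exact le_mul_of_sq_le_mul (P.normA_nonneg z) (P.normB_nonneg v.1) hC h1 h2

/-- A solution operator whose right-hand side lives on sets `S_ℓ ⊆ O_ℓ` is bounded by `C` as soon as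
the energies on the `S_ℓ` add up to at most `C²` times the energy on `D`. -/
theorem isBoundFor_of_sum_dirichletOn_le {S : ι → Set (Pt d)} (h : ∀ l, S l ⊆ P.ov l)
    {T : P.G →ₗ[ℝ] P.H} (hT : ∀ v z, P.a (T v) z = ∑ l, dirichletOn (S l) (v.1 l) z.1) {C : ℝ}
    (hC : 0 ≤ C) (hS : ∀ z : P.H, ∑ l, dirichletOn (S l) z.1 z.1 ≤ C ^ 2 * P.a z z) :
    P.IsBoundFor T C :=
  ⟨hC, fun v => P.normA_le_of_sum_dirichletOn_le h hC v (T v) (hT v (T v)) (hS (T v))⟩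

theorem sum_dirichletOn_sub_le (z : P.H) :
    ∑ l, dirichletOn (P.sub l) z.1 z.1 ≤ P.a z z := by
  have h := integral_iUnion_fintype (μ := volume)
    (f := fun x => (inner ℝ (grad z.1 x) (grad z.1 x) : ℝ))
    (fun l => (P.isOpen_sub l).measurableSet) P.disjoint_sub
    fun l => integrableOn_inner_grad_self (P.sub_subset_D l) z.1
  exact h.symm.trans_le (dirichletOn_self_mono (Set.iUnion_subset P.sub_subset_D) z.1)

theorem a_F (v : P.G) (z : P.H) : P.a (P.F v) z = ∑ l, dirichletOn (P.sub l) (v.1 l) z.1 := by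
  have h : P.F v = ∑ l, P.Floc l (P.comp l v) := by simp [F]
  have h' : ∀ u : P.H, P.a u z =
      dirichletBilin (Set.Subset.refl P.D) (Set.Subset.refl P.D) u z := fun _ => rfl
  rw [h, h', map_sum, LinearMap.sum_apply]
  exact Finset.sum_congr rfl fun l _ => P.a_Floc l _ z

theorem isBoundFor_F : P.IsBoundFor P.F 1 :=
  P.isBoundFor_of_sum_dirichletOn_le P.sub_subset_ov P.a_F zero_le_one fun z => by
    simpa using P.sum_dirichletOn_sub_le z

theorem isBoundFor_Fov : P.IsBoundFor P.Fov √(Fintype.card ι) := by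
  refine P.isBoundFor_of_sum_dirichletOn_le P.diff_subset_ov P.a_Fov (Real.sqrt_nonneg _)
    fun z => ?_
  rw [Real.sq_sqrt (Nat.cast_nonneg _)]
  refine (Finset.sum_le_sum fun l _ => dirichletOn_self_mono (P.diff_subset_D l) z.1).trans
    (le_of_eq ?_)
  simp [a]

theorem Feps_eq (ε : ℝ) : P.Feps ε = P.F + ε • P.Fov := by
  refine (P.existsUnique_Feps ε).unique (P.a_Feps ε) fun v z => ?_
  rw [LinearMap.add_apply, LinearMap.smul_apply, a_add_smul, a_F, a_Fov, c_R]

variable {P}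

theorem IsBoundFor.opNormBA_le {T : P.G →ₗ[ℝ] P.H} {C : ℝ} (h : P.IsBoundFor T C) :
    P.opNormBA T ≤ C :=
  csInf_le ⟨0, fun _ hC => hC.1⟩ h

/-- The infimum that defines the operator norm is attained. -/
theorem IsBoundedBA.isBoundFor_opNormBA {T : P.G →ₗ[ℝ] P.H} (h : P.IsBoundedBA T) :
    P.IsBoundFor T (P.opNormBA T) := by
  refine ⟨le_csInf h fun _ hC => hC.1, fun v => ?_⟩
  rcases (P.normB_nonneg v.1).eq_or_lt with h0 | h0
  · obtain ⟨C, hC⟩ := h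
    simpa [← h0] using hC.2 v
  · rw [← div_le_iff₀ h0]
    exact le_csInf h fun C hC => (div_le_iff₀ h0).2 (hC.2 v)

theorem IsBoundFor.add_smul {T T' : P.G →ₗ[ℝ] P.H} {C C' r : ℝ} (h : P.IsBoundFor T C)
    (h' : P.IsBoundFor T' C') (hr : 0 ≤ r) : P.IsBoundFor (T + r • T') (C + r * C') := by
  refine ⟨add_nonneg h.1 (mul_nonneg hr h'.1), fun v => ?_⟩
  refine (P.normA_add_smul_le (T v) (T' v) hr).trans ?_
  rw [add_mul, mul_assoc]
  exact add_le_add (h.2 v) (mul_le_mul_of_nonneg_left (h'.2 v) hr)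

end Decomposition

end DomainDecomposition

theorem mainTheorem10 {d : ℕ} {ι : Type*} [Fintype ι]
    (P : DomainDecomposition.Decomposition d ι) :
    (P.IsBoundedBA P.F ∧ P.opNormBA P.F ≤ 1) ∧
      P.IsBoundedBA P.Fov ∧
      ∀ ε : ℝ, 0 < ε →
        P.IsBoundedBA (P.Feps ε) ∧ P.opNormBA (P.Feps ε) ≤ 1 + ε * P.opNormBA P.Fov := by
  have hov : P.IsBoundedBA P.Fov := ⟨_, P.isBoundFor_Fov⟩
  refine ⟨⟨⟨1, P.isBoundFor_F⟩, P.isBoundFor_F.opNormBA_le⟩, hov, fun ε hε => ?_⟩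
  have h := P.isBoundFor_F.add_smul hov.isBoundFor_opNormBA hε.le
  rw [← P.Feps_eq] at h
  exact ⟨⟨_, h⟩, h.opNormBA_le⟩
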